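/- Let $X_1, X_2, \dots$ be i.i.d. standard Cauchy random variables, i.e. with density $\frac{1}{\pi(x^2+1)}$ on $\mathbb{R}$. Then $$\frac{1}{n^2}\sum_{i=1}^n X_i^2 \longrightarrow W \quad\text{in distribution as } n\to\infty,$$ where $W$ is an almost surely positive random variable with characteristic function $$\varphi_W(t)=\mathbb{E}\,e^{itW}=\exp\left(-2\sqrt{\frac{-it}{\pi}}\right),\qquad t\in\mathbb{R},$$ (principal branch of the square root) and with probability density $$f_W(w)=\frac{e^{-1/(\pi w)}}{\pi w^{3/2}}\ \text{ for } w>0,\qquad f_W(w)=0\ \text{ for } w\le 0.$$ That is, $W$ has the Lévy law with location $0$ and scale $c=2/\pi$, whose density is $\sqrt{\tfrac{c}{2\pi}}\,e^{-c/(2w)}\,w^{-3/2}$ for $w>0$; this law is strictly stable of index $\tfrac12$: it is non-degenerate and, for independent copies $W_1,W_2$ of $W$ and $a,b>0$, the variable $aW_1+bW_2$ has the law of $(\sqrt a+\sqrt b)^2\,W$. Moreover, $$\frac{n}{\sqrt{\sum_{i=1}^n X_i^2}} \longrightarrow U=\frac{1}{\sqrt{W}} \quad\text{in distribution as } n\to\infty,$$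 and $U$ has the half-normal density $$f_U(u)=\frac{2}{\pi}\,e^{-u^2/\pi}\ \text{ for } u>0,\qquad f_U(u)=0\ \text{ for } u\le 0,$$ i.e. $U$ has the law of $|Z|$ with $Z\sim N(0,\pi/2)$. -/

import Mathlib

open MeasureTheory ProbabilityTheory Filter
open scoped Real NNReal ENNReal

/-- Density of the Lévy law with location `0` and scale `c > 0`:
`√(c / (2π)) * exp (-c / (2x)) / x ^ (3/2)` for `x > 0`, and `0` elsewhere. -/
noncomputable def levyPDFReal (c x : ℝ) : ℝ :=
  if 0 < x then √(c / (2 * π)) * Real.exp (-c / (2 * x)) / x ^ (3 / 2 : ℝ) else 0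

/-- The Lévy law with location `0` and scale `c > 0`. -/
noncomputable def levyMeasure (c : ℝ) : Measure ℝ :=
  volume.withDensity fun x => ENNReal.ofReal (levyPDFReal c x)

/-- The half-normal law: the law of `|Z|` for a centred normal `Z` of variance `v`. -/
noncomputable def halfNormalMeasure (v : ℝ≥0) : Measure ℝ :=
  (gaussianReal 0 v).map fun z => |z|

/-- A non-degenerate probability law `μ` on `ℝ` is strictly stable of index `α > 0` if, for
independent `W₁, W₂ ∼ μ` and all `a, b > 0`, the variable `a W₁ + b W₂` has the law of
`(a ^ α + b ^ α) ^ (1 / α) W₁`. -/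
structure IsStrictlyStable (α : ℝ) (μ : Measure ℝ) : Prop where
  index_pos : 0 < α
  isProbabilityMeasure : IsProbabilityMeasure μ
  nondegenerate : ∀ x : ℝ, μ ≠ Measure.dirac x
  map_eq : ∀ a b : ℝ, 0 < a → 0 < b →
    (μ.prod μ).map (fun p : ℝ × ℝ => a * p.1 + b * p.2) =
      μ.map fun x => (a ^ α + b ^ α) ^ (1 / α) * x

/-- The density `exp (-1 / (π w)) / (π w ^ (3/2))` for `w > 0`, and `0` elsewhere. -/
noncomputable def limitPDFW (w : ℝ) : ℝ :=
  if 0 < w then Real.exp (-(1 / (π * w))) / (π * w ^ (3 / 2 : ℝ)) else 0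

/-- The density `(2 / π) exp (-u ^ 2 / π)` for `u > 0`, and `0` elsewhere. -/
noncomputable def limitPDFU (u : ℝ) : ℝ :=
  if 0 < u then 2 / π * Real.exp (-(u ^ 2 / π)) else 0

/-! A standard Cauchy variable is the ratio `Z / Y` of two independent standard normal variables,
and `L = 1 / Y²` has the Lévy law of scale `1`. Hence `Xᵢ²` has the law of `Zᵢ² Lᵢ`, and by
stability of index `1/2` the sum `∑ Zᵢ² Lᵢ` has the law of `(∑ |Zᵢ|)² L`, conditionally on the
`Zᵢ`. After division by `n²` the law of large numbers leaves `(E |Z|)² L = (2 / π) L`.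

In terms of Laplace transforms, `E exp (-w X²) = E exp (-√(2w) |Z|)`, and the `n`-th power of this
at `w / n²` tends to `exp (-√(2w) E |Z|)`; the values `w = -it` give the characteristic functions.
The Laplace transform `exp (-√(2s))` of `L` comes from completing the square in `y² / 2 + s / y²`,
as `x ↦ x - c / x` preserves Lebesgue measure for `c > 0`. The identity theorem carries it from
real `s > 0` to the closed half-plane `0 ≤ Re s`. -/

open scoped Topology

section ChangeOfVariables

variable {c : ℝ}

lemma lintegral_eq_Ioi_add_Iio (f : ℝ → ℝ≥0∞) :
    ∫⁻ x, f x = (∫⁻ x in Set.Ioi 0, f x) + ∫⁻ x in Set.Iio 0, f x := by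
  rw [← lintegral_add_compl f (measurableSet_Ioi (a := (0 : ℝ))), Set.compl_Ioi,
    setLIntegral_congr Iio_ae_eq_Iic]

lemma lintegral_comp_abs (f : ℝ → ℝ≥0∞) : ∫⁻ x, f |x| = 2 * ∫⁻ x in Set.Ioi 0, f x := by
  have h_pos : ∫⁻ x in Set.Ioi 0, f |x| = ∫⁻ x in Set.Ioi 0, f x :=
    setLIntegral_congr_fun measurableSet_Ioi fun x hx => by rw [abs_of_pos hx]
  have h_neg : ∫⁻ x in Set.Iio 0, f |x| = ∫⁻ x in Set.Ioi 0, f |x| := by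
    simpa using ((Measure.measurePreserving_neg volume).setLIntegral_comp_preimage_emb
      (Homeomorph.neg ℝ).measurableEmbedding (fun x => f |x|) (Set.Iio 0)).symm
  rw [lintegral_eq_Ioi_add_Iio, h_neg, h_pos, two_mul]

lemma hasDerivAt_const_div (c : ℝ) {x : ℝ} (hx : x ≠ 0) :
    HasDerivAt (fun x : ℝ => c / x) (-(c / x ^ 2)) x := by
  simpa [div_eq_mul_inv] using (hasDerivAt_inv hx).const_mul c

lemma image_neg_const_div_Ioi (hc : 0 < c) :
    (fun x : ℝ => -(c / x)) '' Set.Ioi 0 = Set.Iio 0 := by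
  ext y
  refine ⟨?_, fun hy => ⟨-(c / y), ?_, ?_⟩⟩
  · rintro ⟨x, hx, rfl⟩
    exact neg_lt_zero.2 (div_pos hc hx)
  · exact neg_pos.2 (div_neg_of_pos_of_neg hc hy)
  · change -(c / -(c / y)) = y
    rw [div_neg, neg_neg, div_div_cancel₀ hc.ne']

lemma image_sub_const_div_Ioi (hc : 0 < c) :
    (fun x : ℝ => x - c / x) '' Set.Ioi 0 = Set.univ := by
  refine Set.eq_univ_of_forall fun y => ?_
  have h_lt : |y| < √(y ^ 2 + 4 * c) :=
    Real.lt_sqrt_of_sq_lt (by rw [sq_abs]; linarith)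
  have h_sq : √(y ^ 2 + 4 * c) ^ 2 = y ^ 2 + 4 * c := Real.sq_sqrt (by positivity)
  have h_pos : 0 < y + √(y ^ 2 + 4 * c) := by linarith [neg_abs_le y]
  refine ⟨(y + √(y ^ 2 + 4 * c)) / 2, half_pos h_pos, ?_⟩
  field_simp [h_pos.ne']
  linear_combination h_sq

lemma strictMonoOn_sub_const_div (hc : 0 < c) :
    StrictMonoOn (fun x : ℝ => x - c / x) (Set.Ioi 0) := fun _ hx _ _ hxy =>
  sub_lt_sub hxy (div_lt_div_of_pos_left hc hx hxy)

lemma setLIntegral_Iio_comp_sub_const_div (hc : 0 < c) (f : ℝ → ℝ≥0∞) :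
    ∫⁻ x in Set.Iio 0, f (x - c / x) =
      ∫⁻ x in Set.Ioi 0, ENNReal.ofReal (c / x ^ 2) * f (x - c / x) := by
  have h_mono : StrictMonoOn (fun x : ℝ => -(c / x)) (Set.Ioi 0) := fun _ hx _ _ hxy =>
    neg_lt_neg (div_lt_div_of_pos_left hc hx hxy)
  rw [← image_neg_const_div_Ioi hc, lintegral_image_eq_lintegral_abs_deriv_mul measurableSet_Ioi
    (fun x hx => (hasDerivAt_const_div c (ne_of_gt hx)).fun_neg.hasDerivWithinAt) h_mono.injOn]
  refine setLIntegral_congr_fun measurableSet_Ioi fun x _ => ?_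
  have h_arg : -(c / x) - c / -(c / x) = x - c / x := by
    rw [div_neg, div_div_cancel₀ hc.ne']
    ring
  simp only [neg_neg, abs_of_nonneg (div_nonneg hc.le (sq_nonneg x)), h_arg]

theorem measurePreserving_sub_const_div (hc : 0 < c) :
    MeasurePreserving fun x : ℝ => x - c / x := by
  have h_meas : Measurable fun x : ℝ => x - c / x := by fun_prop
  refine ⟨h_meas, Measure.ext_of_lintegral _ fun f hf => ?_⟩
  have h_deriv : ∀ x ∈ Set.Ioi (0 : ℝ),
      HasDerivWithinAt (fun x => x - c / x) (1 + c / x ^ 2) (Set.Ioi 0) x := fun x hx => by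
    simpa using! ((hasDerivAt_id x).sub (hasDerivAt_const_div c (ne_of_gt hx))).hasDerivWithinAt
  calc ∫⁻ y, f y ∂volume.map (fun x => x - c / x)
      = ∫⁻ x, f (x - c / x) := lintegral_map hf h_meas
    _ = ∫⁻ x in Set.Ioi 0, (f (x - c / x) + ENNReal.ofReal (c / x ^ 2) * f (x - c / x)) := by
        rw [lintegral_eq_Ioi_add_Iio, setLIntegral_Iio_comp_sub_const_div hc,
          lintegral_add_left (by fun_prop)]
    _ = ∫⁻ x in Set.Ioi 0, ENNReal.ofReal (1 + c / x ^ 2) * f (x - c / x) := by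
        refine lintegral_congr fun x => ?_
        rw [ENNReal.ofReal_add one_pos.le (by positivity), ENNReal.ofReal_one, add_mul, one_mul]
    _ = ∫⁻ y in (fun x => x - c / x) '' Set.Ioi 0, f y :=
        (lintegral_image_eq_lintegral_deriv_mul_of_monotoneOn measurableSet_Ioi h_deriv
          (strictMonoOn_sub_const_div hc).monotoneOn f).symm
    _ = ∫⁻ y, f y := by rw [image_sub_const_div_Ioi hc, setLIntegral_univ]

end ChangeOfVariables

section HalfPlane

lemma closure_setOf_re_pos : closure {z : ℂ | 0 < z.re} = {z : ℂ | 0 ≤ z.re} :=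
  Complex.closure_setOfPred_lt_re 0

theorem eqOn_re_nonneg_of_eq_ofReal {E : Type*} [NormedAddCommGroup E] [NormedSpace ℂ E]
    [CompleteSpace E] {f g : ℂ → E} (hf : DiffContOnCl ℂ f {z | 0 < z.re})
    (hg : DiffContOnCl ℂ g {z | 0 < z.re}) (hfg : ∀ x : ℝ, 0 < x → f x = g x) :
    Set.EqOn f g {z | 0 ≤ z.re} := by
  have h_open : IsOpen {z : ℂ | 0 < z.re} := isOpen_lt continuous_const Complex.continuous_re
  have h_lim : Tendsto (fun x : ℝ => (x : ℂ)) (𝓝[≠] 1) (𝓝[≠] 1) :=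
    tendsto_nhdsWithin_of_tendsto_nhds_of_eventually_within _
      ((Complex.continuous_ofReal.tendsto' 1 1 Complex.ofReal_one).mono_left nhdsWithin_le_nhds)
      (by filter_upwards [self_mem_nhdsWithin] with x hx using by simpa using hx)
  have h_freq : ∃ᶠ z in 𝓝[≠] (1 : ℂ), f z = g z := by
    refine h_lim.frequently (Eventually.frequently ?_)
    filter_upwards [mem_nhdsWithin_of_mem_nhds (Ioi_mem_nhds one_pos)] with x hx using hfg x hx
  have h_eqOn : Set.EqOn f g {z | 0 < z.re} :=
    (hf.differentiableOn.analyticOnNhd h_open).eqOn_of_preconnected_of_frequently_eq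
      (hg.differentiableOn.analyticOnNhd h_open) (convex_halfSpace_re_gt 0).isPreconnected
      (z₀ := 1) (by simp) h_freq
  exact closure_setOf_re_pos ▸
    h_eqOn.of_subset_closure hf.continuousOn hg.continuousOn subset_closure le_rfl

lemma diffContOnCl_cpow_const {r : ℂ} (hr : 0 < r.re) :
    DiffContOnCl ℂ (fun z : ℂ => z ^ r) {z | 0 < z.re} where
  differentiableOn z hz :=
    (differentiableAt_id.cpow_const (Or.inl hz)).differentiableWithinAt
  continuousOn := by
    rw [closure_setOf_re_pos]
    intro z hz
    refine ContinuousAt.continuousWithinAt ?_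
    rcases (show 0 ≤ z.re from hz).lt_or_eq with h_re | h_re
    · exact continuousAt_cpow_const (Or.inl h_re)
    · by_cases h_im : z.im = 0
      · exact Complex.continuousAt_cpow_const_of_re_pos (Or.inl h_re.le) hr
      · exact continuousAt_cpow_const (Or.inr h_im)

lemma ofReal_mul_cpow {a : ℝ} (ha : 0 ≤ a) (z r : ℂ) : (a * z) ^ r = (a : ℂ) ^ r * z ^ r := by
  rcases eq_or_ne r 0 with rfl | hr
  · simp
  rcases ha.eq_or_lt with rfl | ha
  · simp [Complex.zero_cpow hr]
  rcases eq_or_ne z 0 with rfl | hz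
  · simp [Complex.zero_cpow hr]
  have ha' : (a : ℂ) ≠ 0 := Complex.ofReal_ne_zero.2 ha.ne'
  rw [Complex.cpow_def_of_ne_zero (mul_ne_zero ha' hz), Complex.cpow_def_of_ne_zero ha',
    Complex.cpow_def_of_ne_zero hz, Complex.log_ofReal_mul ha hz, Complex.ofReal_log ha.le,
    add_mul, Complex.exp_add]

lemma ofReal_cpow_one_half {a : ℝ} (ha : 0 ≤ a) : (a : ℂ) ^ (1 / 2 : ℂ) = (√a : ℝ) := by
  rw [Real.sqrt_eq_rpow, Complex.ofReal_cpow ha]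
  norm_num

lemma ofReal_mul_cpow_one_half {a : ℝ} (ha : 0 ≤ a) (z : ℂ) :
    (a * z) ^ (1 / 2 : ℂ) = √a * z ^ (1 / 2 : ℂ) := by
  rw [ofReal_mul_cpow ha, ofReal_cpow_one_half ha]

lemma cpow_one_half_re_nonneg (z : ℂ) : 0 ≤ (z ^ (1 / 2 : ℂ)).re := by
  rw [one_div, Complex.cpow_inv_two_re]
  positivity

end HalfPlane

section LaplaceTransform

variable {Ω : Type*} [MeasurableSpace Ω] {μ : Measure Ω} {X : Ω → ℝ}

lemma norm_cexp_neg_mul_ofReal_le_one {w : ℂ} (hw : 0 ≤ w.re) {x : ℝ} (hx : 0 ≤ x) :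
    ‖Complex.exp (-w * x)‖ ≤ 1 := by
  rw [Complex.norm_exp, Real.exp_le_one_iff, Complex.re_mul_ofReal, Complex.neg_re]
  exact mul_nonpos_of_nonpos_of_nonneg (neg_nonpos.2 hw) hx

lemma Iic_subset_integrableExpSet [IsFiniteMeasure μ] (hX : AEMeasurable X μ)
    (hX_nonneg : 0 ≤ᵐ[μ] X) : Set.Iic 0 ⊆ integrableExpSet X μ := fun t ht => by
  refine Integrable.of_bound (by fun_prop) 1 ?_
  filter_upwards [hX_nonneg] with ω hω
  rw [Real.norm_of_nonneg (Real.exp_pos _).le, Real.exp_le_one_iff]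
  exact mul_nonpos_of_nonpos_of_nonneg ht hω

theorem diffContOnCl_complexMGF_neg [IsFiniteMeasure μ] (hX : AEMeasurable X μ)
    (hX_nonneg : 0 ≤ᵐ[μ] X) :
    DiffContOnCl ℂ (fun w => complexMGF X μ (-w)) {w | 0 < w.re} where
  differentiableOn := by
    refine differentiableOn_complexMGF.comp differentiableOn_id.neg fun w hw => ?_
    refine interior_mono (Iic_subset_integrableExpSet hX hX_nonneg) ?_
    rw [interior_Iic]
    exact neg_lt_zero.2 (show 0 < w.re from hw)
  continuousOn := by
    rw [closure_setOf_re_pos]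
    refine continuousOn_of_dominated (bound := fun _ => 1) (fun w _ => by fun_prop)
      (fun w hw => ?_) (integrable_const _)
      (Eventually.of_forall fun ω => Continuous.continuousOn (by fun_prop))
    filter_upwards [hX_nonneg] with ω hω using norm_cexp_neg_mul_ofReal_le_one hw hω

end LaplaceTransform

section InverseSquareOfGaussian

variable {v : ℝ≥0}

/- Complete the square: `z² / (2v) + s / z² = (z - c / z)² / (2v) + c / v` for `c = √(2vs)`. -/
lemma gaussianPDFReal_mul_exp_neg_mul_inv_sq (hv : v ≠ 0) {s : ℝ} (hs : 0 ≤ s) {z : ℝ}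
    (hz : z ≠ 0) :
    gaussianPDFReal 0 v z * Real.exp (-s * (z ^ 2)⁻¹) =
      Real.exp (-√(2 * s / v)) * gaussianPDFReal 0 v (z - √(2 * v * s) / z) := by
  have hv' : (v : ℝ) ≠ 0 := NNReal.coe_ne_zero.2 hv
  have h_sq : √(2 * v * s) ^ 2 = 2 * v * s := Real.sq_sqrt (by positivity)
  have h_div : √(2 * s / v) = √(2 * v * s) / v := by
    rw [show 2 * s / v = 2 * v * s / (v : ℝ) ^ 2 by field_simp, Real.sqrt_div' _ (sq_nonneg _),
      Real.sqrt_sq v.coe_nonneg]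
  rw [gaussianPDFReal, gaussianPDFReal, mul_assoc, mul_left_comm (Real.exp _), ← Real.exp_add,
    ← Real.exp_add, h_div]
  congr 2
  field_simp
  linear_combination h_sq

theorem integral_exp_neg_mul_inv_sq_gaussianReal (hv : v ≠ 0) {s : ℝ} (hs : 0 < s) :
    ∫ z, Real.exp (-s * (z ^ 2)⁻¹) ∂gaussianReal 0 v = Real.exp (-√(2 * s / v)) := by
  have hc : 0 < √(2 * v * s) := by positivity
  have h_map := (measurePreserving_sub_const_div hc).map_eq
  calc ∫ z, Real.exp (-s * (z ^ 2)⁻¹) ∂gaussianReal 0 v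
      = ∫ z, gaussianPDFReal 0 v z * Real.exp (-s * (z ^ 2)⁻¹) := by
        rw [integral_gaussianReal_eq_integral_smul hv]
        rfl
    _ = ∫ z, Real.exp (-√(2 * s / v)) * gaussianPDFReal 0 v (z - √(2 * v * s) / z) := by
        refine integral_congr_ae ?_
        filter_upwards [Measure.ae_ne volume 0] with z hz
        exact gaussianPDFReal_mul_exp_neg_mul_inv_sq hv hs.le hz
    _ = Real.exp (-√(2 * s / v)) * ∫ z, gaussianPDFReal 0 v z := by
        rw [integral_const_mul, ← integral_map (by fun_prop) (by fun_prop), h_map]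
    _ = Real.exp (-√(2 * s / v)) := by rw [integral_gaussianPDFReal_eq_one 0 hv, mul_one]

theorem complexMGF_inv_sq_gaussianReal (hv : v ≠ 0) {w : ℂ} (hw : 0 ≤ w.re) :
    complexMGF (fun z => (z ^ 2)⁻¹) (gaussianReal 0 v) (-w) =
      Complex.exp (-(2 * w / v) ^ (1 / 2 : ℂ)) := by
  have h_scale : ∀ w : ℂ, (2 * w / v) ^ (1 / 2 : ℂ) = √(2 / v) * w ^ (1 / 2 : ℂ) := fun w => by
    rw [← ofReal_mul_cpow_one_half (by positivity)]
    push_cast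
    ring_nf
  have h_rhs : DiffContOnCl ℂ (fun w : ℂ => Complex.exp (-(2 * w / v) ^ (1 / 2 : ℂ)))
      {w | 0 < w.re} := by
    simp only [h_scale]
    exact Complex.differentiable_exp.comp_diffContOnCl
      ((diffContOnCl_cpow_const (by norm_num)).const_smul (√(2 / v) : ℂ)).neg
  refine eqOn_re_nonneg_of_eq_ofReal (diffContOnCl_complexMGF_neg (by fun_prop)
    (Eventually.of_forall fun z => inv_nonneg.2 (sq_nonneg z))) h_rhs (fun s hs => ?_) hw
  have h_mgf : mgf (fun z => (z ^ 2)⁻¹) (gaussianReal 0 v) (-s) = Real.exp (-√(2 * s / v)) :=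
    integral_exp_neg_mul_inv_sq_gaussianReal hv hs
  rw [← Complex.ofReal_neg, complexMGF_ofReal, h_mgf, Complex.ofReal_exp, Complex.ofReal_neg,
    ← ofReal_cpow_one_half (by positivity)]
  push_cast
  rfl

end InverseSquareOfGaussian

section LevyLaw

variable {v : ℝ≥0} {c : ℝ}

@[fun_prop]
lemma measurable_levyPDFReal (c : ℝ) : Measurable (levyPDFReal c) :=
  Measurable.ite measurableSet_Ioi (by fun_prop) measurable_const

lemma lintegral_levyMeasure (c : ℝ) {f : ℝ → ℝ≥0∞} (hf : Measurable f) :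
    ∫⁻ x, f x ∂levyMeasure c = ∫⁻ x in Set.Ioi 0, ENNReal.ofReal (levyPDFReal c x) * f x := by
  rw [levyMeasure, lintegral_withDensity_eq_lintegral_mul _ (by fun_prop) hf,
    ← lintegral_indicator measurableSet_Ioi]
  refine lintegral_congr fun x => ?_
  by_cases hx : 0 < x <;> simp [levyPDFReal, hx]

lemma lintegral_comp_abs_gaussianReal (hv : v ≠ 0) {f : ℝ → ℝ≥0∞} (hf : Measurable f) :
    ∫⁻ z, f |z| ∂gaussianReal 0 v = ∫⁻ z in Set.Ioi 0, 2 * gaussianPDF 0 v z * f z := by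
  have h_even : ∀ z, gaussianPDF 0 v |z| = gaussianPDF 0 v z := fun z => by
    simp [gaussianPDF, gaussianPDFReal]
  calc ∫⁻ z, f |z| ∂gaussianReal 0 v
      = ∫⁻ z, gaussianPDF 0 v |z| * f |z| := by
        rw [gaussianReal_of_var_ne_zero _ hv,
          lintegral_withDensity_eq_lintegral_mul _ (by fun_prop) (by fun_prop)]
        simp only [Pi.mul_apply, h_even]
    _ = ∫⁻ z in Set.Ioi 0, 2 * gaussianPDF 0 v z * f z := by
        rw [lintegral_comp_abs fun z => gaussianPDF 0 v z * f z,
          ← lintegral_const_mul _ (by fun_prop)]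
        simp only [mul_assoc]

theorem halfNormalMeasure_eq_withDensity (hv : v ≠ 0) :
    halfNormalMeasure v =
      volume.withDensity ((Set.Ioi 0).indicator fun u => 2 * gaussianPDF 0 v u) := by
  refine Measure.ext_of_lintegral _ fun f hf => ?_
  rw [halfNormalMeasure, lintegral_map hf (by fun_prop), lintegral_comp_abs_gaussianReal hv hf,
    withDensity_indicator measurableSet_Ioi,
    lintegral_withDensity_eq_lintegral_mul _ (by fun_prop) hf]
  rfl

lemma image_inv_sq_Ioi : (fun u : ℝ => (u ^ 2)⁻¹) '' Set.Ioi 0 = Set.Ioi 0 := by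
  ext w
  refine ⟨?_, fun hw => ⟨(√w)⁻¹, inv_pos.2 (Real.sqrt_pos.2 hw), ?_⟩⟩
  · rintro ⟨u, hu, rfl⟩
    exact inv_pos.2 (pow_pos (Set.mem_Ioi.1 hu) 2)
  · change ((√w)⁻¹ ^ 2)⁻¹ = w
    rw [inv_pow, inv_inv, Real.sq_sqrt (le_of_lt hw)]

lemma injOn_inv_sq_Ioi : Set.InjOn (fun u : ℝ => (u ^ 2)⁻¹) (Set.Ioi 0) := fun _ hx _ hy h =>
  (pow_left_inj₀ (le_of_lt hx) (le_of_lt hy) two_ne_zero).1 (inv_injective h)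

lemma hasDerivAt_inv_sq {u : ℝ} (hu : u ≠ 0) :
    HasDerivAt (fun u : ℝ => (u ^ 2)⁻¹) (-(2 / u ^ 3)) u := by
  refine ((hasDerivAt_pow 2 u).fun_inv (pow_ne_zero 2 hu)).congr_deriv ?_
  push_cast
  field_simp

lemma two_div_cube_mul_levyPDFReal_inv_sq (v : ℝ≥0) {u : ℝ} (hu : 0 < u) :
    2 / u ^ 3 * levyPDFReal (v : ℝ)⁻¹ (u ^ 2)⁻¹ = 2 * gaussianPDFReal 0 v u := by
  have h_pow : ((u ^ 2)⁻¹ : ℝ) ^ (3 / 2 : ℝ) = (u ^ 3)⁻¹ := by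
    rw [Real.inv_rpow (by positivity), ← Real.rpow_natCast u 2, ← Real.rpow_mul hu.le,
      ← Real.rpow_natCast u 3]
    norm_num
  have h_sqrt : √((v : ℝ)⁻¹ / (2 * π)) = (√(2 * π * v))⁻¹ := by
    rw [← Real.sqrt_inv, mul_inv, div_eq_inv_mul]
  have h_exp : -(v : ℝ)⁻¹ / (2 * (u ^ 2)⁻¹) = -(u - 0) ^ 2 / (2 * v) := by
    rw [sub_zero]
    field_simp
  rw [levyPDFReal, if_pos (by positivity), gaussianPDFReal, h_pow, h_sqrt, h_exp]
  field_simp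

theorem map_inv_sq_gaussianReal (hv : v ≠ 0) :
    (gaussianReal 0 v).map (fun z => (z ^ 2)⁻¹) = levyMeasure (v : ℝ)⁻¹ := by
  refine Measure.ext_of_lintegral _ fun f hf => ?_
  rw [lintegral_levyMeasure _ hf, ← image_inv_sq_Ioi,
    lintegral_image_eq_lintegral_abs_deriv_mul measurableSet_Ioi
      (fun u hu => (hasDerivAt_inv_sq (ne_of_gt hu)).hasDerivWithinAt) injOn_inv_sq_Ioi,
    lintegral_map hf (by fun_prop)]
  calc ∫⁻ z, f (z ^ 2)⁻¹ ∂gaussianReal 0 v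
      = ∫⁻ z in Set.Ioi 0, 2 * gaussianPDF 0 v z * f (z ^ 2)⁻¹ := by
        rw [← lintegral_comp_abs_gaussianReal hv (by fun_prop)]
        simp only [sq_abs]
    _ = ∫⁻ u in Set.Ioi 0, ENNReal.ofReal |-(2 / u ^ 3)| *
          (ENNReal.ofReal (levyPDFReal (v : ℝ)⁻¹ (u ^ 2)⁻¹) * f (u ^ 2)⁻¹) := by
        refine setLIntegral_congr_fun measurableSet_Ioi fun u hu => ?_
        have hu' : 0 < u := hu
        simp only [← mul_assoc]
        rw [abs_neg, abs_of_pos (by positivity), ← ENNReal.ofReal_mul (by positivity),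
          two_div_cube_mul_levyPDFReal_inv_sq v hu', ENNReal.ofReal_mul zero_le_two,
          ENNReal.ofReal_ofNat, gaussianPDF]

lemma levyMeasure_eq_map_gaussianReal (hc : 0 < c) :
    levyMeasure c = (gaussianReal 0 c⁻¹.toNNReal).map fun z => (z ^ 2)⁻¹ := by
  rw [map_inv_sq_gaussianReal (Real.toNNReal_pos.2 (inv_pos.2 hc)).ne',
    Real.coe_toNNReal _ (inv_pos.2 hc).le, inv_inv]

theorem isProbabilityMeasure_levyMeasure (hc : 0 < c) : IsProbabilityMeasure (levyMeasure c) := by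
  rw [levyMeasure_eq_map_gaussianReal hc]
  exact Measure.isProbabilityMeasure_map (by fun_prop)

lemma levyMeasure_absolutelyContinuous (c : ℝ) : levyMeasure c ≪ volume :=
  withDensity_absolutelyContinuous _ _

lemma ae_pos_levyMeasure (c : ℝ) : ∀ᵐ w ∂levyMeasure c, 0 < w := by
  rw [levyMeasure, ae_withDensity_iff (by fun_prop)]
  refine Eventually.of_forall fun w => not_imp_comm.1 fun hw => ?_
  rw [levyPDFReal, if_neg hw, ENNReal.ofReal_zero]

theorem map_one_div_sqrt_levyMeasure (hc : 0 < c) :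
    (levyMeasure c).map (fun w => 1 / √w) = halfNormalMeasure c⁻¹.toNNReal := by
  rw [levyMeasure_eq_map_gaussianReal hc, Measure.map_map (by fun_prop) (by fun_prop),
    halfNormalMeasure]
  congr 1
  ext z
  rw [Function.comp_apply, Real.sqrt_inv, Real.sqrt_sq_eq_abs, one_div, inv_inv]

theorem charFun_levyMeasure (hc : 0 < c) (t : ℝ) :
    charFun (levyMeasure c) t = Complex.exp (-(-(2 * c * (t * Complex.I))) ^ (1 / 2 : ℂ)) := by
  have hv : c⁻¹.toNNReal ≠ 0 := (Real.toNNReal_pos.2 (inv_pos.2 hc)).ne'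
  rw [levyMeasure_eq_map_gaussianReal hc, ← complexMGF_mul_I (by fun_prop),
    ← neg_neg (t * Complex.I : ℂ), complexMGF_inv_sq_gaussianReal hv (by simp),
    Real.coe_toNNReal _ (inv_pos.2 hc).le]
  push_cast
  rw [div_inv_eq_mul]
  ring_nf

lemma charFun_levyMeasure_mul (hc : 0 < c) {r : ℝ} (hr : 0 ≤ r) (t : ℝ) :
    charFun (levyMeasure c) (r * t) =
      Complex.exp (√r * -(-(2 * c * (t * Complex.I))) ^ (1 / 2 : ℂ)) := by
  rw [charFun_levyMeasure hc, mul_neg, ← ofReal_mul_cpow_one_half hr]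
  push_cast
  ring_nf

theorem isStrictlyStable_levyMeasure (hc : 0 < c) : IsStrictlyStable (1 / 2) (levyMeasure c) where
  index_pos := one_half_pos
  isProbabilityMeasure := isProbabilityMeasure_levyMeasure hc
  nondegenerate x hx := by
    have h_singleton := levyMeasure_absolutelyContinuous c (Real.volume_singleton (a := x))
    simp [hx] at h_singleton
  map_eq a b ha hb := by
    have := isProbabilityMeasure_levyMeasure hc
    have (r : ℝ) : IsProbabilityMeasure ((levyMeasure c).map (r * ·)) :=
      Measure.isProbabilityMeasure_map (by fun_prop)
    have h_scale : ((a ^ (1 / 2 : ℝ) + b ^ (1 / 2 : ℝ)) ^ (1 / (1 / 2) : ℝ) : ℝ) =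
        (√a + √b) ^ 2 := by
      rw [Real.sqrt_eq_rpow, Real.sqrt_eq_rpow, one_div_one_div, Real.rpow_two]
    have h_pair : (fun p : ℝ × ℝ => a * p.1 + b * p.2) =
        (fun p : ℝ × ℝ => p.1 + p.2) ∘ Prod.map (a * ·) (b * ·) := rfl
    refine Measure.ext_of_charFun (funext fun t => ?_)
    rw [h_scale, h_pair, ← Measure.map_map (by fun_prop) (by fun_prop),
      ← Measure.map_prod_map _ _ (by fun_prop) (by fun_prop), charFun_map_add_prod_eq_mul,
      Pi.mul_apply, charFun_map_mul, charFun_map_mul, charFun_map_mul,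
      charFun_levyMeasure_mul hc ha.le, charFun_levyMeasure_mul hc hb.le,
      charFun_levyMeasure_mul hc (sq_nonneg _), Real.sqrt_sq (by positivity), ← Complex.exp_add,
      ← add_mul, Complex.ofReal_add]

end LevyLaw

section LimitLaws

lemma levyPDFReal_two_div_pi : levyPDFReal (2 / π) = limitPDFW := by
  ext w
  unfold levyPDFReal limitPDFW
  split_ifs with hw
  · have h_sqrt : √(2 / π / (2 * π)) = π⁻¹ := by
      rw [show 2 / π / (2 * π) = π⁻¹ ^ 2 by field_simp, Real.sqrt_sq (by positivity)]
    have h_exp : -(2 / π) / (2 * w) = -(1 / (π * w)) := by field_simp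
    rw [h_sqrt, h_exp]
    field_simp
  · rfl

theorem charFun_levyMeasure_two_div_pi (t : ℝ) :
    charFun (levyMeasure (2 / π)) t =
      Complex.exp (-2 * (-(Complex.I * t) / π) ^ (1 / 2 : ℂ)) := by
  have h_root : (-(2 * (2 / π : ℝ) * (t * Complex.I))) ^ (1 / 2 : ℂ) =
      2 * (-(Complex.I * t) / π) ^ (1 / 2 : ℂ) := by
    have h := ofReal_mul_cpow_one_half (sq_nonneg 2) (-(Complex.I * t) / π)
    rw [Real.sqrt_sq zero_le_two] at h
    push_cast at h ⊢
    rw [← h]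
    ring_nf
  rw [charFun_levyMeasure (by positivity), h_root, neg_mul]

lemma two_mul_gaussianPDFReal_pi_div_two (u : ℝ) :
    2 * gaussianPDFReal 0 (π / 2).toNNReal u = 2 / π * Real.exp (-(u ^ 2 / π)) := by
  have h_sqrt : √(2 * π * (π / 2)) = π := by
    rw [show 2 * π * (π / 2) = π ^ 2 by ring, Real.sqrt_sq Real.pi_pos.le]
  have h_exp : -(u - 0) ^ 2 / (2 * (π / 2)) = -(u ^ 2 / π) := by ring
  rw [gaussianPDFReal, Real.coe_toNNReal _ (by positivity), h_sqrt, h_exp, ← mul_assoc,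
    ← div_eq_mul_inv]

theorem halfNormalMeasure_pi_div_two :
    halfNormalMeasure (π / 2).toNNReal =
      volume.withDensity fun u => ENNReal.ofReal (limitPDFU u) := by
  rw [halfNormalMeasure_eq_withDensity (Real.toNNReal_pos.2 (by positivity)).ne']
  congr 1
  ext u
  by_cases hu : 0 < u
  · rw [Set.indicator_of_mem (Set.mem_Ioi.2 hu), limitPDFU, if_pos hu, gaussianPDF,
      ← ENNReal.ofReal_ofNat 2, ← ENNReal.ofReal_mul zero_le_two,
      two_mul_gaussianPDFReal_pi_div_two]
  · rw [Set.indicator_of_notMem (by simpa using hu), limitPDFU, if_neg hu, ENNReal.ofReal_zero]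

end LimitLaws

section RatioOfGaussians

lemma lintegral_eq_lintegral_comp_mul_right {a : ℝ} (ha : a ≠ 0) {f : ℝ → ℝ≥0∞}
    (hf : Measurable f) : ∫⁻ x, f x = ∫⁻ u, ENNReal.ofReal |a| * f (u * a) := by
  conv_lhs => rw [← Real.smul_map_volume_mul_right ha]
  rw [lintegral_smul_measure, lintegral_map hf (by fun_prop), smul_eq_mul,
    lintegral_const_mul _ (by fun_prop)]

theorem map_div_prod_withDensity {f g : ℝ → ℝ≥0∞} (hf : Measurable f) (hg : Measurable g) :
    ((volume.withDensity f).prod (volume.withDensity g)).map (fun p => p.1 / p.2) =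
      volume.withDensity fun u => ∫⁻ y, ENNReal.ofReal |y| * (f (u * y) * g y) := by
  refine Measure.ext_of_lintegral _ fun h hh => ?_
  calc ∫⁻ u, h u ∂((volume.withDensity f).prod (volume.withDensity g)).map (fun p => p.1 / p.2)
      = ∫⁻ p : ℝ × ℝ, f p.1 * g p.2 * h (p.1 / p.2) := by
        rw [lintegral_map hh (by fun_prop), prod_withDensity hf hg,
          lintegral_withDensity_eq_lintegral_mul _ (by fun_prop) (by fun_prop)]
        rfl
    _ = ∫⁻ y, ∫⁻ x, f x * g y * h (x / y) := lintegral_prod_symm' _ (by fun_prop)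
    _ = ∫⁻ y, ∫⁻ u, ENNReal.ofReal |y| * (f (u * y) * g y) * h u := by
        refine lintegral_congr_ae ?_
        filter_upwards [Measure.ae_ne volume 0] with y hy
        rw [lintegral_eq_lintegral_comp_mul_right hy (by fun_prop)]
        simp only [mul_div_cancel_right₀ _ hy, mul_assoc]
    _ = ∫⁻ u, ∫⁻ y, ENNReal.ofReal |y| * (f (u * y) * g y) * h u :=
        lintegral_lintegral_swap (by fun_prop)
    _ = ∫⁻ u, h u ∂volume.withDensity fun u => ∫⁻ y, ENNReal.ofReal |y| * (f (u * y) * g y) := by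
        rw [lintegral_withDensity_eq_lintegral_mul _ (by fun_prop) hh]
        exact lintegral_congr fun u => lintegral_mul_const _ (by fun_prop)

lemma integral_abs_mul_exp_neg_mul_sq {b : ℝ} (hb : 0 < b) :
    ∫ x : ℝ, |x| * Real.exp (-b * x ^ 2) = b⁻¹ := by
  have h_half : ∫ x in Set.Ioi (0 : ℝ), x * Real.exp (-b * x ^ 2) = (2 * b)⁻¹ := by
    have h := integral_mul_cexp_neg_mul_sq (b := b) (by simpa using hb)
    exact_mod_cast h
  have h_even := integral_comp_abs (f := fun x => x * Real.exp (-b * x ^ 2))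
  simp only [sq_abs] at h_even
  rw [h_even, h_half]
  field_simp

lemma integrable_abs_mul_exp_neg_mul_sq {b : ℝ} (hb : 0 < b) :
    Integrable fun x : ℝ => |x| * Real.exp (-b * x ^ 2) :=
  .of_integral_ne_zero (by rw [integral_abs_mul_exp_neg_mul_sq hb]; exact (inv_pos.2 hb).ne')

lemma gaussianPDFReal_zero_sq (σ : ℝ≥0) (x : ℝ) :
    gaussianPDFReal 0 (σ ^ 2) x =
      (√(2 * π) * σ)⁻¹ * Real.exp (-(2 * (σ : ℝ) ^ 2)⁻¹ * x ^ 2) := by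
  rw [gaussianPDFReal, NNReal.coe_pow, Real.sqrt_mul' _ (sq_nonneg _), Real.sqrt_sq σ.coe_nonneg,
    sub_zero, neg_div, neg_mul, div_eq_inv_mul]

lemma gaussianPDFReal_mul_gaussianPDFReal (σ τ : ℝ≥0) (u y : ℝ) :
    gaussianPDFReal 0 (σ ^ 2) (u * y) * gaussianPDFReal 0 (τ ^ 2) y =
      (2 * π * σ * τ)⁻¹ *
        Real.exp (-((2 * (σ : ℝ) ^ 2)⁻¹ * u ^ 2 + (2 * (τ : ℝ) ^ 2)⁻¹) * y ^ 2) := by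
  have h_sqrt : √(2 * π) * √(2 * π) = 2 * π := Real.mul_self_sqrt (by positivity)
  rw [gaussianPDFReal_zero_sq, gaussianPDFReal_zero_sq, mul_mul_mul_comm, ← Real.exp_add,
    ← mul_inv, mul_mul_mul_comm, h_sqrt, mul_assoc (2 * π)]
  ring_nf

lemma lintegral_abs_mul_gaussianPDF_mul {σ τ : ℝ≥0} (hσ : σ ≠ 0) (hτ : τ ≠ 0) (u : ℝ) :
    ∫⁻ y, ENNReal.ofReal |y| * (gaussianPDF 0 (σ ^ 2) (u * y) * gaussianPDF 0 (τ ^ 2) y) =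
      cauchyPDF 0 (σ / τ) u := by
  have hb : 0 < (2 * (σ : ℝ) ^ 2)⁻¹ * u ^ 2 + (2 * (τ : ℝ) ^ 2)⁻¹ := by positivity
  calc ∫⁻ y, ENNReal.ofReal |y| * (gaussianPDF 0 (σ ^ 2) (u * y) * gaussianPDF 0 (τ ^ 2) y)
      = ∫⁻ y, ENNReal.ofReal ((2 * π * σ * τ)⁻¹ * (|y| *
          Real.exp (-((2 * (σ : ℝ) ^ 2)⁻¹ * u ^ 2 + (2 * (τ : ℝ) ^ 2)⁻¹) * y ^ 2))) := by
        refine lintegral_congr fun y => ?_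
        rw [mul_left_comm (_)⁻¹, ← gaussianPDFReal_mul_gaussianPDFReal,
          ENNReal.ofReal_mul (abs_nonneg y), ENNReal.ofReal_mul (gaussianPDFReal_nonneg _ _ _)]
        rfl
    _ = ENNReal.ofReal ((2 * π * σ * τ)⁻¹ *
          ((2 * (σ : ℝ) ^ 2)⁻¹ * u ^ 2 + (2 * (τ : ℝ) ^ 2)⁻¹)⁻¹) := by
        rw [← ofReal_integral_eq_lintegral_ofReal
          ((integrable_abs_mul_exp_neg_mul_sq hb).const_mul _)
          (Eventually.of_forall fun y => by positivity), integral_const_mul,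
          integral_abs_mul_exp_neg_mul_sq hb]
    _ = cauchyPDF 0 (σ / τ) u := by
        rw [cauchyPDF, cauchyPDFReal]
        congr 1
        push_cast
        field_simp
        ring

theorem map_div_prod_gaussianReal {σ τ : ℝ≥0} (hσ : σ ≠ 0) (hτ : τ ≠ 0) :
    ((gaussianReal 0 (σ ^ 2)).prod (gaussianReal 0 (τ ^ 2))).map (fun p => p.1 / p.2) =
      cauchyMeasure 0 (σ / τ) := by
  rw [cauchyMeasure_of_scale_ne_zero _ (div_ne_zero hσ hτ),
    gaussianReal_of_var_ne_zero _ (pow_ne_zero 2 hσ),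
    gaussianReal_of_var_ne_zero _ (pow_ne_zero 2 hτ),
    map_div_prod_withDensity (by fun_prop) (by fun_prop)]
  simp only [lintegral_abs_mul_gaussianPDF_mul hσ hτ]

end RatioOfGaussians

section SquareOfCauchy

lemma integral_abs_gaussianReal_sq {σ : ℝ≥0} (hσ : σ ≠ 0) :
    ∫ z, |z| ∂gaussianReal 0 (σ ^ 2) = √(2 / π) * σ := by
  have h_sqrt : √(2 / π) = 2 / √(2 * π) := by
    rw [show 2 / π = 2 ^ 2 / (2 * π) by field_simp, Real.sqrt_div (sq_nonneg _),
      Real.sqrt_sq zero_le_two]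
  calc ∫ z, |z| ∂gaussianReal 0 (σ ^ 2)
      = ∫ z, (√(2 * π) * σ)⁻¹ * (|z| * Real.exp (-(2 * (σ : ℝ) ^ 2)⁻¹ * z ^ 2)) := by
        rw [integral_gaussianReal_eq_integral_smul (pow_ne_zero 2 hσ)]
        simp only [gaussianPDFReal_zero_sq, smul_eq_mul, mul_comm |_|, mul_assoc]
    _ = (√(2 * π) * σ)⁻¹ * (2 * (σ : ℝ) ^ 2)⁻¹⁻¹ := by
        rw [integral_const_mul, integral_abs_mul_exp_neg_mul_sq (by positivity)]
    _ = √(2 / π) * σ := by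
        rw [h_sqrt]
        field_simp

theorem complexMGF_sq_cauchyMeasure {γ : ℝ≥0} (hγ : γ ≠ 0) {w : ℂ} (hw : 0 ≤ w.re) :
    complexMGF (fun x => x ^ 2) (cauchyMeasure 0 γ) (-w) =
      complexMGF (fun z => |z|) (gaussianReal 0 (γ ^ 2)) (-(2 * w) ^ (1 / 2 : ℂ)) := by
  have h_ratio : cauchyMeasure 0 γ =
      ((gaussianReal 0 (γ ^ 2)).prod (gaussianReal 0 1)).map fun p => p.1 / p.2 := by
    simpa using (map_div_prod_gaussianReal hγ one_ne_zero).symm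
  have h_int : Integrable (fun p : ℝ × ℝ => Complex.exp (-w * ((p.1 / p.2) ^ 2 : ℝ)))
      ((gaussianReal 0 (γ ^ 2)).prod (gaussianReal 0 1)) :=
    .of_bound (by fun_prop) 1 (Eventually.of_forall fun p =>
      norm_cexp_neg_mul_ofReal_le_one hw (sq_nonneg _))
  have h_inner (z : ℝ) : ∫ y, Complex.exp (-w * ((z / y) ^ 2 : ℝ)) ∂gaussianReal 0 1 =
      Complex.exp (-(2 * w) ^ (1 / 2 : ℂ) * |z|) := by
    have hw_z : 0 ≤ ((z ^ 2 : ℝ) * w).re := by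
      rw [Complex.re_ofReal_mul]
      exact mul_nonneg (sq_nonneg z) hw
    calc ∫ y, Complex.exp (-w * ((z / y) ^ 2 : ℝ)) ∂gaussianReal 0 1
        = complexMGF (fun y => (y ^ 2)⁻¹) (gaussianReal 0 1) (-((z ^ 2 : ℝ) * w)) := by
          refine integral_congr_ae (Eventually.of_forall fun y => ?_)
          change Complex.exp (-w * ((z / y) ^ 2 : ℝ)) =
            Complex.exp (-((z ^ 2 : ℝ) * w) * ((y ^ 2)⁻¹ : ℝ))
          push_cast
          ring_nf
      _ = Complex.exp (-((z ^ 2 : ℝ) * (2 * w)) ^ (1 / 2 : ℂ)) := by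
          rw [complexMGF_inv_sq_gaussianReal one_ne_zero hw_z, NNReal.coe_one, Complex.ofReal_one,
            div_one, mul_left_comm]
      _ = Complex.exp (-(2 * w) ^ (1 / 2 : ℂ) * |z|) := by
          rw [ofReal_mul_cpow_one_half (sq_nonneg z), Real.sqrt_sq_eq_abs, neg_mul, mul_comm]
  rw [complexMGF, h_ratio, integral_map (by fun_prop) (by fun_prop), integral_prod _ h_int]
  simp only [h_inner]
  rfl

end SquareOfCauchy

section ExponentialLimit

lemma norm_cexp_sub_one_le_norm {z : ℂ} (hz : z.re ≤ 0) : ‖Complex.exp z - 1‖ ≤ ‖z‖ := by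
  have h := (convex_halfSpace_re_le 0).norm_image_sub_le_of_norm_deriv_le (f := Complex.exp)
    (C := 1) (fun x _ => Complex.differentiableAt_exp)
    (fun x hx => by simpa [Complex.norm_exp] using hx) (show (0 : ℂ).re ≤ 0 by simp) hz
  simpa using h

lemma div_natCast_re_nonpos {z : ℂ} (hz : z.re ≤ 0) (n : ℕ) : (z / n).re ≤ 0 := by
  rw [Complex.div_natCast_re]
  exact div_nonpos_of_nonpos_of_nonneg hz n.cast_nonneg

lemma norm_natCast_mul_cexp_div_sub_one_le {z : ℂ} (hz : z.re ≤ 0) (n : ℕ) :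
    ‖n * (Complex.exp (z / n) - 1)‖ ≤ ‖z‖ := by
  rcases eq_or_ne n 0 with rfl | hn
  · simp
  · calc ‖n * (Complex.exp (z / n) - 1)‖ = ‖(n : ℂ)‖ * ‖Complex.exp (z / n) - 1‖ := norm_mul _ _
      _ ≤ ‖(n : ℂ)‖ * ‖z / n‖ := by
          gcongr
          exact norm_cexp_sub_one_le_norm (div_natCast_re_nonpos hz n)
      _ = ‖z‖ := by rw [← norm_mul, mul_div_cancel₀ _ (Nat.cast_ne_zero.2 hn)]

lemma tendsto_natCast_mul_cexp_div_sub_one (z : ℂ) :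
    Tendsto (fun n : ℕ => n * (Complex.exp (z / n) - 1)) atTop (𝓝 z) := by
  have h_deriv : HasDerivAt (fun s : ℂ => Complex.exp (z * s)) z 0 := by
    simpa using ((hasDerivAt_id (0 : ℂ)).const_mul z).cexp
  have h_inv : Tendsto (fun n : ℕ => (n : ℂ)⁻¹) atTop (𝓝[≠] 0) :=
    tendsto_nhdsWithin_iff.2 ⟨tendsto_inv_atTop_nhds_zero_nat,
      (eventually_ne_atTop 0).mono fun n hn => inv_ne_zero (Nat.cast_ne_zero.2 hn)⟩
  simpa [Function.comp_def, div_eq_mul_inv] using h_deriv.tendsto_slope_zero.comp h_inv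

theorem tendsto_integral_cexp_div_pow {Ω : Type*} [MeasurableSpace Ω] {μ : Measure Ω}
    [IsProbabilityMeasure μ] {f : Ω → ℂ} (hf : Integrable f μ) (hf_re : ∀ᵐ ω ∂μ, (f ω).re ≤ 0) :
    Tendsto (fun n : ℕ => (∫ ω, Complex.exp (f ω / n) ∂μ) ^ n) atTop
      (𝓝 (Complex.exp (∫ ω, f ω ∂μ))) := by
  have h_meas (n : ℕ) : AEStronglyMeasurable (fun ω => Complex.exp (f ω / n)) μ :=
    Complex.continuous_exp.comp_aestronglyMeasurable (hf.div_const _).aestronglyMeasurable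
  have h_int (n : ℕ) : Integrable (fun ω => Complex.exp (f ω / n)) μ := by
    refine .of_bound (h_meas n) 1 ?_
    filter_upwards [hf_re] with ω hω
    rw [Complex.norm_exp, Real.exp_le_one_iff]
    exact div_natCast_re_nonpos hω n
  have h_lim : Tendsto (fun n : ℕ => ∫ ω, n * (Complex.exp (f ω / n) - 1) ∂μ) atTop
      (𝓝 (∫ ω, f ω ∂μ)) := by
    refine tendsto_integral_of_dominated_convergence (fun ω => ‖f ω‖)
      (fun n => ((h_meas n).sub aestronglyMeasurable_const).const_mul _) hf.norm (fun n => ?_)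
      (Eventually.of_forall fun ω => tendsto_natCast_mul_cexp_div_sub_one (f ω))
    filter_upwards [hf_re] with ω hω using norm_natCast_mul_cexp_div_sub_one_le hω n
  have h_eq (n : ℕ) : ∫ ω, n * (Complex.exp (f ω / n) - 1) ∂μ =
      n * (∫ ω, Complex.exp (f ω / n) ∂μ - 1) := by
    rw [integral_const_mul, integral_sub (h_int n) (integrable_const 1)]
    simp
  simp only [h_eq] at h_lim
  simpa only [add_sub_cancel] using Complex.tendsto_one_add_pow_exp_of_tendsto h_lim

end ExponentialLimit

section SumsOfSquares

variable {Ω : Type*} [MeasurableSpace Ω] {P : Measure Ω} {X : ℕ → Ω → ℝ}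

lemma charFun_map_sum_div {ν : Measure ℝ} (hX : ∀ i, HasLaw (X i) ν P) (h_indep : iIndepFun X P)
    (n : ℕ) (b t : ℝ) :
    charFun (P.map fun ω => (∑ i ∈ Finset.range n, X i ω) / b) t = charFun ν (b⁻¹ * t) ^ n := by
  simp_rw [div_eq_inv_mul]
  rw [charFun_map_mul_comp (Finset.aemeasurable_fun_sum _ fun i _ => (hX i).aemeasurable),
    (h_indep.restrict _).charFun_map_fun_finsetSum_eq_prod fun i _ => (hX i).aemeasurable]
  simp [(hX _).map_eq]

lemma charFun_map_sq_cauchyMeasure {γ : ℝ≥0} (hγ : γ ≠ 0) (n : ℕ) (t : ℝ) :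
    charFun ((cauchyMeasure 0 γ).map (· ^ 2)) (((n : ℝ) ^ 2)⁻¹ * t) =
      ∫ z, Complex.exp (-(-(2 * (t * Complex.I))) ^ (1 / 2 : ℂ) * |z| / n)
        ∂gaussianReal 0 (γ ^ 2) := by
  have h_re : 0 ≤ (-((((n : ℝ) ^ 2)⁻¹ * t : ℝ) * Complex.I)).re := by
    rw [Complex.neg_re, Complex.re_ofReal_mul, Complex.I_re, mul_zero, neg_zero]
  have h_root : (2 * -((((n : ℝ) ^ 2)⁻¹ * t : ℝ) * Complex.I)) ^ (1 / 2 : ℂ) =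
      (n : ℂ)⁻¹ * (-(2 * (t * Complex.I))) ^ (1 / 2 : ℂ) := by
    have h := ofReal_mul_cpow_one_half (inv_nonneg.2 (sq_nonneg (n : ℝ)))
      (-(2 * (t * Complex.I)))
    rw [Real.sqrt_inv, Real.sqrt_sq n.cast_nonneg] at h
    push_cast at h ⊢
    rw [← h]
    ring_nf
  rw [← complexMGF_mul_I (by fun_prop), ← neg_neg (_ * Complex.I),
    complexMGF_sq_cauchyMeasure hγ h_re, h_root]
  refine integral_congr_ae (Eventually.of_forall fun z => ?_)
  ring_nf

lemma charFun_levyMeasure_two_div_pi_mul_sq {γ : ℝ≥0} (hγ : γ ≠ 0) (t : ℝ) :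
    charFun (levyMeasure (2 / π * γ ^ 2)) t =
      Complex.exp (∫ z, -(-(2 * (t * Complex.I))) ^ (1 / 2 : ℂ) * (|z| : ℝ)
        ∂gaussianReal 0 (γ ^ 2)) := by
  have h_sqrt : √(2 / π * γ ^ 2) = √(2 / π) * γ := by
    rw [Real.sqrt_mul' _ (sq_nonneg _), Real.sqrt_sq γ.coe_nonneg]
  rw [charFun_levyMeasure (by positivity), integral_const_mul, integral_complex_ofReal,
    integral_abs_gaussianReal_sq hγ, ← h_sqrt, neg_mul, mul_comm (_ ^ (1 / 2 : ℂ)),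
    ← ofReal_mul_cpow_one_half (by positivity)]
  ring_nf

theorem tendstoInDistribution_sum_sq_div_sq [IsProbabilityMeasure P] {γ : ℝ≥0} (hγ : γ ≠ 0)
    (hX : ∀ i, HasLaw (X i) (cauchyMeasure 0 γ) P) (h_indep : iIndepFun X P)
    {Ω' : Type*} [MeasurableSpace Ω'] {P' : Measure Ω'} [IsProbabilityMeasure P'] {W : Ω' → ℝ}
    (hW : HasLaw W (levyMeasure (2 / π * γ ^ 2)) P') :
    TendstoInDistribution (fun (n : ℕ) ω => (∑ i ∈ Finset.range n, X i ω ^ 2) / (n : ℝ) ^ 2)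
      atTop W (fun _ => P) P' := by
  have h_sq : HasLaw (· ^ 2) ((cauchyMeasure 0 γ).map (· ^ 2)) (cauchyMeasure 0 γ) :=
    ⟨by fun_prop, rfl⟩
  have hX_sq (i : ℕ) : HasLaw (fun ω => X i ω ^ 2) ((cauchyMeasure 0 γ).map (· ^ 2)) P :=
    h_sq.comp (hX i)
  have h_indep_sq : iIndepFun (fun i ω => X i ω ^ 2) P :=
    h_indep.comp (fun _ x => x ^ 2) fun _ => by fun_prop
  refine ⟨fun n => ?_, hW.aemeasurable,
    ProbabilityMeasure.tendsto_iff_tendsto_charFun.2 fun t => ?_⟩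
  · exact (Finset.aemeasurable_fun_sum _ fun i _ => (hX_sq i).aemeasurable).div_const _
  simp only [ProbabilityMeasure.coe_mk, hW.map_eq, charFun_map_sum_div hX_sq h_indep_sq,
    charFun_map_sq_cauchyMeasure hγ, charFun_levyMeasure_two_div_pi_mul_sq hγ]
  refine tendsto_integral_cexp_div_pow ?_ (Eventually.of_forall fun z => ?_)
  · exact ((memLp_id_gaussianReal 1).integrable le_rfl).abs.ofReal.const_mul _
  · rw [neg_mul, Complex.neg_re, Complex.re_mul_ofReal]
    exact neg_nonpos.2 (mul_nonneg (cpow_one_half_re_nonneg _) (abs_nonneg z))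

end SumsOfSquares

section ContinuousMapping

theorem tendstoInDistribution_comp_of_ae_continuousAt {ι E F Ω' : Type*} {Ω : ι → Type*}
    {m : ∀ i, MeasurableSpace (Ω i)} {μ : (i : ι) → Measure (Ω i)}
    [∀ i, IsProbabilityMeasure (μ i)] {m' : MeasurableSpace Ω'} {μ' : Measure Ω'}
    [IsProbabilityMeasure μ'] [MeasurableSpace E] [TopologicalSpace E] [OpensMeasurableSpace E]
    [HasOuterApproxClosed E] [MeasurableSpace F] [TopologicalSpace F] [OpensMeasurableSpace F]
    {X : (i : ι) → Ω i → E} {Z : Ω' → E} {l : Filter ι} [l.IsCountablyGenerated] {g : E → F}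
    (h : TendstoInDistribution X l Z μ μ') (hg : Measurable g)
    (hg_cont : ∀ᵐ ω ∂μ', ContinuousAt g (Z ω)) :
    TendstoInDistribution (fun n => g ∘ X n) l (g ∘ Z) μ μ' where
  forall_aemeasurable n := hg.comp_aemeasurable (h.forall_aemeasurable n)
  aemeasurable_limit := hg.comp_aemeasurable h.aemeasurable_limit
  tendsto := by
    refine tendsto_of_forall_isOpen_le_liminf' fun G hG => ?_
    have hG_meas : MeasurableSet (g ⁻¹' G) := hg hG.measurableSet
    have hX_map (n : ι) : (μ n).map (g ∘ X n) = ((μ n).map (X n)).map g :=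
      (AEMeasurable.map_map_of_aemeasurable hg.aemeasurable (h.forall_aemeasurable n)).symm
    have hZ_map : μ'.map (g ∘ Z) = (μ'.map Z).map g :=
      (AEMeasurable.map_map_of_aemeasurable hg.aemeasurable h.aemeasurable_limit).symm
    simp only [ProbabilityMeasure.coe_mk, hX_map, hZ_map, Measure.map_apply hg hG.measurableSet]
    calc μ'.map Z (g ⁻¹' G)
        ≤ μ'.map Z (interior (g ⁻¹' G)) := by
          rw [Measure.map_apply_of_aemeasurable h.aemeasurable_limit hG_meas,
            Measure.map_apply_of_aemeasurable h.aemeasurable_limit measurableSet_interior]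
          refine measure_mono_ae ?_
          filter_upwards [hg_cont] with ω hω hω_mem using
            mem_interior_iff_mem_nhds.2 (hω.preimage_mem_nhds (hG.mem_nhds hω_mem))
      _ ≤ liminf (fun n => (μ n).map (X n) (interior (g ⁻¹' G))) l :=
          ProbabilityMeasure.le_liminf_measure_open_of_tendsto h.tendsto isOpen_interior
      _ ≤ liminf (fun n => (μ n).map (X n) (g ⁻¹' G)) l :=
          liminf_le_liminf (Eventually.of_forall fun n => measure_mono interior_subset)

end ContinuousMapping

section ReciprocalSquareRoot

lemma tendstoInDistribution_div_sqrt {Ω Ω' : Type*} [MeasurableSpace Ω] [MeasurableSpace Ω']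
    {P : Measure Ω} [IsProbabilityMeasure P] {P' : Measure Ω'} [IsProbabilityMeasure P']
    {S : ℕ → Ω → ℝ} {W : Ω' → ℝ}
    (h : TendstoInDistribution (fun (n : ℕ) ω => S n ω / (n : ℝ) ^ 2) atTop W (fun _ => P) P')
    (hW : ∀ᵐ ω ∂P', 0 < W ω) :
    TendstoInDistribution (fun (n : ℕ) ω => (n : ℝ) / √(S n ω)) atTop (fun ω => 1 / √(W ω))
      (fun _ => P) P' := by
  have h_cont : ∀ᵐ ω ∂P', ContinuousAt (fun x => 1 / √x) (W ω) := by
    filter_upwards [hW] with ω hω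
    exact continuousAt_const.div Real.continuous_sqrt.continuousAt (Real.sqrt_pos.2 hω).ne'
  refine (tendstoInDistribution_comp_of_ae_continuousAt h (by fun_prop) h_cont).congr
    (fun n => Eventually.of_forall fun ω => ?_) (ae_eq_refl _)
  rw [Function.comp_apply, Real.sqrt_div' _ (sq_nonneg _), Real.sqrt_sq n.cast_nonneg, one_div_div]

end ReciprocalSquareRoot

theorem mainTheorem1 {Ω : Type*} [MeasurableSpace Ω] (P : Measure Ω) [IsProbabilityMeasure P]
    (X : ℕ → Ω → ℝ) (hlaw : ∀ i, HasLaw (X i) (cauchyMeasure 0 1) P) (hindep : iIndepFun X P) :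
    ∃ (Ω' : Type) (_ : MeasurableSpace Ω') (P' : Measure Ω') (_ : IsProbabilityMeasure P')
      (W : Ω' → ℝ),
      -- convergence in distribution of the normalized sums of squares to `W`
      TendstoInDistribution
        (fun (n : ℕ) ω => (∑ i ∈ Finset.range n, X i ω ^ 2) / (n : ℝ) ^ 2)
        atTop W (fun _ => P) P' ∧
      -- the law of `W`: characteristic function, density, Lévy law, stability of index `1/2`
      (∀ t : ℝ, charFun (P'.map W) t =
        Complex.exp (-2 * (-(Complex.I * (t : ℂ)) / (π : ℂ)) ^ (1 / 2 : ℂ))) ∧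
      HasLaw W (volume.withDensity fun w => ENNReal.ofReal (limitPDFW w)) P' ∧
      HasLaw W (levyMeasure (2 / π)) P' ∧
      IsStrictlyStable (1 / 2) (P'.map W) ∧
      (∀ᵐ ω ∂P', 0 < W ω) ∧
      -- convergence in distribution of the reciprocal square roots to `U = 1 / √W`
      TendstoInDistribution
        (fun (n : ℕ) ω => (n : ℝ) / √(∑ i ∈ Finset.range n, X i ω ^ 2))
        atTop (fun ω => 1 / √(W ω)) (fun _ => P) P' ∧
      -- the law of `U`: density and half-normal law
      HasLaw (fun ω => 1 / √(W ω))
        (volume.withDensity fun u => ENNReal.ofReal (limitPDFU u)) P' ∧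
      HasLaw (fun ω => 1 / √(W ω)) (halfNormalMeasure (π / 2).toNNReal) P' := by
  have h_pos : (0 : ℝ) < 2 / π := by positivity
  have := isProbabilityMeasure_levyMeasure h_pos
  have hW : HasLaw id (levyMeasure (2 / π)) (levyMeasure (2 / π)) := .id
  have hU : HasLaw (fun w => 1 / √w) (halfNormalMeasure (π / 2).toNNReal) (levyMeasure (2 / π)) :=
    ⟨by fun_prop, by rw [map_one_div_sqrt_levyMeasure h_pos, inv_div]⟩
  have h_lim := tendstoInDistribution_sum_sq_div_sq one_ne_zero hlaw hindep (by simpa using hW)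
  refine ⟨ℝ, inferInstance, levyMeasure (2 / π), inferInstance, id, h_lim, fun t => ?_, ?_, hW, ?_,
    ae_pos_levyMeasure _, ?_, halfNormalMeasure_pi_div_two ▸ hU, hU⟩
  · rw [Measure.map_id, charFun_levyMeasure_two_div_pi]
  · rwa [← levyPDFReal_two_div_pi]
  · rw [Measure.map_id]
    exact isStrictlyStable_levyMeasure h_pos
  · exact tendstoInDistribution_div_sqrt h_lim (ae_pos_levyMeasure _)
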